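/- **Proposition 3 (Sufficient condition for equivalence of value conditions).** Let $f(\rho)=\rho\,v(\rho)$, $\rho\in[0,\rho_{max}]$, $\rho_{max}>0$, be a fundamental diagram: $v$ is decreasing with values in $[0,v_{max}]$, and $f$ is concave and attains its maximum on $[0,\rho_{max}]$. Put $\psi(s)=f(1/s)\,s$ and let $\delta>0$. Consider the Hamilton–Jacobi equations $$N_t-f(-N_x)=0\quad\text{(Eulerian)},\qquad X_t-\psi(-X_n)=0\quad\text{(Lagrangian)}$$ on domains $\Omega^E$ of points $(t,x)$ and $\Omega^L$ of points $(t,n)$ whose time slices are intervals that vary lower semicontinuously with $t$ (for instance products of two intervals, or open sets whose time slices are intervals). Let $\mathcal C^E$ and $\mathcal C^L$ be continuous value conditions, whose domains are continuous curves $(t(\tau),x(\tau))\in\Omega^E$ and $(t(\tau),n(\tau))\in\Omega^L$, $\tau\in[\tau_{min},\tau_{max}]$, and which are continuous functions of $\tau$ along them. An *Eulerian solution* is a function $N$, continuous on $\Omega^E$, that is a viscosity solution of the Eulerian equation in the interior of $\Omega^E$, whose density $-N_x$ lies in $[\delta,\rho_{max}]$ (that is, $\delta(x_2-x_1)\le N(t,x_1)-N(t,x_2)\le\rho_{max}(x_2-x_1)$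 for $(t,x_1),(t,x_2)\in\Omega^E$, $x_1\le x_2$), and that satisfies the value condition in the equality sense, $N(t(\tau),x(\tau))=\mathcal C^E(t(\tau),x(\tau))$ for all $\tau$. A *Lagrangian solution* is a function $X$, continuous on $\Omega^L$, that is a viscosity solution of the Lagrangian equation in the interior of $\Omega^L$, whose spacing $-X_n$ lies in $[1/\rho_{max},1/\delta]$ in the same sense, and that satisfies $X(t(\tau),n(\tau))=\mathcal C^L(t(\tau),n(\tau))$ for all $\tau$. The *image* of $N$ is $\{(t,N(t,x)):(t,x)\in\Omega^E\}$, that of $X$ is $\{(t,X(t,n)):(t,n)\in\Omega^L\}$. $N$ and $X$ are *partial inverses* of each other if for each $t$ the functions $N(t,\cdot)$ and $X(t,\cdot)$ are mutually inverse bijections between the time slices of $\Omega^E$ and $\Omega^L$. Suppose that for all $\tau\in[\tau_{min},\tau_{max}]$ $$n(\tau)=\mathcal C^E\big(t(\tau),x(\tau)\big),\qquad x(\tau)=\mathcal C^L\big(t(\tau),n(\tau)\big).$$ Then the solutions of the two problems are equivalent: 1. Every Eulerian solution $N$ with image $\Omega^L$ has a partial inverse, and this is a Lagrangian solution (it satisfies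 $\mathcal C^L$). Every Lagrangian solution $X$ with image $\Omega^E$ has a partial inverse, and this is an Eulerian solution (it satisfies $\mathcal C^E$). 2. Hence the Eulerian solution, inverted in $x$, is the Lagrangian solution, whenever the latter is uniquely determined: if $N$ is an Eulerian solution with image $\Omega^L$, and $X$ is a Lagrangian solution with which every Lagrangian solution with image $\Omega^E$ agrees on $\Omega^L$, then $N$ and $X$ are partial inverses of each other. The same holds with the two roles exchanged. 3. There is exactly one Eulerian solution with image $\Omega^L$ if and only if there is exactly one Lagrangian solution with image $\Omega^E$ (as functions on $\Omega^E$ and $\Omega^L$). -/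

import Mathlib

open Set Filter Topology

namespace LWR

/-- `f` is a fundamental diagram with speed function `v`: the flow is `f ρ = ρ v(ρ)` for densities
`ρ ∈ [0, ρmax]`, the speed `v` is decreasing with values in `[0, vmax]`, and `f` is concave and
attains its maximum (the flow capacity) at some `ρ* ∈ [0, ρmax]`. -/
structure IsFundamentalDiagram (f v : ℝ → ℝ) (ρmax vmax : ℝ) : Prop where
  ρmax_pos : 0 < ρmax
  flow_eq : ∀ ρ ∈ Icc 0 ρmax, f ρ = ρ * v ρ
  speed_mem : ∀ ρ ∈ Icc 0 ρmax, v ρ ∈ Icc 0 vmax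
  speed_anti : AntitoneOn v (Icc 0 ρmax)
  concave : ConcaveOn ℝ (Icc 0 ρmax) f
  exists_max : ∃ ρstar ∈ Icc 0 ρmax, IsMaxOn f (Icc 0 ρmax) ρstar

/-- The spacing-velocity relation `ψ(s) = f(1/s) s`. -/
noncomputable def spacingVelocity (f : ℝ → ℝ) (s : ℝ) : ℝ := f (1 / s) * s

/-- The space-time domains considered (points are `(t, y)`, with `y` a position or a vehicle label):
every time slice is an interval, and the slices vary lower semicontinuously with time.
All products `I ×ˢ J` of two intervals are of this kind, and so are all open sets whose time slices
are intervals. -/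
structure IsDomain (Ω : Set (ℝ × ℝ)) : Prop where
  slice : ∀ t : ℝ, {y : ℝ | (t, y) ∈ Ω}.OrdConnected
  lsc : ∀ p ∈ Ω, ∀ ε > (0 : ℝ), ∀ᶠ t in 𝓝[Prod.fst '' Ω] p.1, ∃ y : ℝ, (t, y) ∈ Ω ∧ |y - p.2| < ε

/-- `u` is a viscosity subsolution of `u_t + H(u_y) = 0` on `Ω`: it is continuous on `Ω` and
`φ_t + H(φ_y) ≤ 0` at every interior point of `Ω` at which `u - φ` has a local maximum, for every
`φ` that is continuously differentiable near that point. -/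
def IsViscositySubsolution (H : ℝ → ℝ) (Ω : Set (ℝ × ℝ)) (u : ℝ × ℝ → ℝ) : Prop :=
  ContinuousOn u Ω ∧
    ∀ (φ : ℝ × ℝ → ℝ), ∀ p ∈ interior Ω, ContDiffAt ℝ 1 φ p → IsLocalMax (fun q => u q - φ q) p →
      fderiv ℝ φ p (1, 0) + H (fderiv ℝ φ p (0, 1)) ≤ 0

/-- `u` is a viscosity supersolution of `u_t + H(u_y) = 0` on `Ω`. -/
def IsViscositySupersolution (H : ℝ → ℝ) (Ω : Set (ℝ × ℝ)) (u : ℝ × ℝ → ℝ) : Prop :=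
  ContinuousOn u Ω ∧
    ∀ (φ : ℝ × ℝ → ℝ), ∀ p ∈ interior Ω, ContDiffAt ℝ 1 φ p → IsLocalMin (fun q => u q - φ q) p →
      0 ≤ fderiv ℝ φ p (1, 0) + H (fderiv ℝ φ p (0, 1))

/-- `u` is a viscosity solution of `u_t + H(u_y) = 0` on `Ω`. -/
def IsViscositySolution (H : ℝ → ℝ) (Ω : Set (ℝ × ℝ)) (u : ℝ × ℝ → ℝ) : Prop :=
  IsViscositySubsolution H Ω u ∧ IsViscositySupersolution H Ω u

/-- `a ≤ -u_y ≤ b` on `Ω`, in integrated form: on every time slice `u` is decreasing in `y`, at a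
rate between `a` and `b`. For a Moskowitz function `-u_y` is the density, for the position function
of the vehicles it is the spacing. -/
def DecreasesAtRate (a b : ℝ) (Ω : Set (ℝ × ℝ)) (u : ℝ × ℝ → ℝ) : Prop :=
  ∀ t y₁ y₂ : ℝ, (t, y₁) ∈ Ω → (t, y₂) ∈ Ω → y₁ ≤ y₂ →
    a * (y₂ - y₁) ≤ u (t, y₁) - u (t, y₂) ∧ u (t, y₁) - u (t, y₂) ≤ b * (y₂ - y₁)

/-- `C` is a continuous value condition on `Ω`: its domain is the continuous curve
`τ ↦ (t τ, y τ)`, `τ ∈ [τmin, τmax]`, contained in `Ω`, and `τ ↦ C (t τ, y τ)` is continuous.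
The values of `C` off the curve are never used. -/
structure IsValueCondition (Ω : Set (ℝ × ℝ)) (τmin τmax : ℝ) (t y : ℝ → ℝ)
    (C : ℝ × ℝ → ℝ) : Prop where
  le : τmin ≤ τmax
  continuousOn_time : ContinuousOn t (Icc τmin τmax)
  continuousOn_space : ContinuousOn y (Icc τmin τmax)
  mem : ∀ τ ∈ Icc τmin τmax, (t τ, y τ) ∈ Ω
  continuousOn_value : ContinuousOn (fun τ => C (t τ, y τ)) (Icc τmin τmax)

/-- `u` satisfies the value condition `C` in the equality sense. -/
def SatisfiesValue (τmin τmax : ℝ) (t y : ℝ → ℝ) (C u : ℝ × ℝ → ℝ) : Prop :=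
  ∀ τ ∈ Icc τmin τmax, u (t τ, y τ) = C (t τ, y τ)

/-- `N` solves the Eulerian problem on `Ω`: it is a viscosity solution of `N_t - f(-N_x) = 0`,
its density `-N_x` lies in `[δ, ρmax]`, and `N = C` along the curve `(t, x)`. -/
structure IsEulerianSolution (f : ℝ → ℝ) (δ ρmax : ℝ) (Ω : Set (ℝ × ℝ)) (τmin τmax : ℝ)
    (t x : ℝ → ℝ) (C N : ℝ × ℝ → ℝ) : Prop where
  viscosity : IsViscositySolution (fun p => -f (-p)) Ω N
  density : DecreasesAtRate δ ρmax Ω N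
  value : SatisfiesValue τmin τmax t x C N

/-- `X` solves the Lagrangian problem on `Ω`: it is a viscosity solution of `X_t - ψ(-X_n) = 0`,
its spacing `-X_n` lies in `[1/ρmax, 1/δ]`, and `X = C` along the curve `(t, n)`. -/
structure IsLagrangianSolution (f : ℝ → ℝ) (δ ρmax : ℝ) (Ω : Set (ℝ × ℝ)) (τmin τmax : ℝ)
    (t n : ℝ → ℝ) (C X : ℝ × ℝ → ℝ) : Prop where
  viscosity : IsViscositySolution (fun p => -spacingVelocity f (-p)) Ω X
  spacing : DecreasesAtRate (1 / ρmax) (1 / δ) Ω X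
  value : SatisfiesValue τmin τmax t n C X

/-- The image `{(t, u(t, y)) | (t, y) ∈ Ω}`, that is, the domain of the partial inverse of `u`. -/
def dualDomain (Ω : Set (ℝ × ℝ)) (u : ℝ × ℝ → ℝ) : Set (ℝ × ℝ) :=
  (fun p : ℝ × ℝ => (p.1, u p)) '' Ω

/-- `N` on `ΩE` and `X` on `ΩL` are partial inverses of each other: for each fixed time `t`,
`X(t, ·)` is the inverse of `N(t, ·)`, as maps between the time slices of `ΩE` and `ΩL`. -/
def ArePartialInverses (ΩE ΩL : Set (ℝ × ℝ)) (N X : ℝ × ℝ → ℝ) : Prop :=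
  (∀ t x : ℝ, (t, x) ∈ ΩE → (t, N (t, x)) ∈ ΩL ∧ X (t, N (t, x)) = x) ∧
    (∀ t n : ℝ, (t, n) ∈ ΩL → (t, X (t, n)) ∈ ΩE ∧ N (t, X (t, n)) = n)

end LWR

/-!
A partial inverse is again continuous, because the original decreases at a rate bounded below and
because lower semicontinuity of the slices means that the projection of the domain onto its times is
an open map. Let `φ` be a `C¹` test function touching the
inverse `X` of `N` from above. The rate bounds force `φ_n < 0`, so by the implicit function theorem
`φ` has a local partial inverse `Φ`, which touches `N` *also from above*, since both `X` and `φ`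
decrease. With `(A, B) = (φ_t, φ_n)`, the gradient of `Φ` is `(-A/B, 1/B)`, and
`A - ψ(-B) = -B (-A/B - f(-1/B))`, with a positive factor `-B`. Inversion therefore turns one
equation into the other, sub- and supersolutions separately.
-/

namespace LWR

section PartialInverses

variable {Ω Ω' : Set (ℝ × ℝ)} {u w w' : ℝ × ℝ → ℝ} {a b : ℝ}

theorem ArePartialInverses.symm (h : ArePartialInverses Ω Ω' u w) :
    ArePartialInverses Ω' Ω w u :=
  ⟨h.2, h.1⟩

theorem ArePartialInverses.congr_right (h : ArePartialInverses Ω Ω' u w) (hw : EqOn w w' Ω') :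
    ArePartialInverses Ω Ω' u w' := by
  refine ⟨fun t y hy => ?_, fun t z hz => hw hz ▸ h.2 t z hz⟩
  obtain ⟨hmem, hinv⟩ := h.1 t y hy
  exact ⟨hmem, (hw hmem).symm.trans hinv⟩

theorem ArePartialInverses.eqOn (h : ArePartialInverses Ω Ω' u w)
    (h' : ArePartialInverses Ω Ω' u w') : EqOn w w' Ω' := by
  rintro ⟨t, z⟩ hz
  obtain ⟨hmem, hinv⟩ := h.2 t z hz
  simpa only [hinv] using (h'.1 _ _ hmem).2.symm

theorem ArePartialInverses.dualDomain_eq (h : ArePartialInverses Ω Ω' u w) :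
    dualDomain Ω u = Ω' := by
  refine Subset.antisymm (image_subset_iff.2 fun p hp => (h.1 _ _ hp).1) fun q hq => ?_
  obtain ⟨hmem, hinv⟩ := h.2 _ _ hq
  exact ⟨_, hmem, Prod.ext rfl hinv⟩

theorem DecreasesAtRate.strictAntiOn (hu : DecreasesAtRate a b Ω u) (ha : 0 < a) (t : ℝ) :
    StrictAntiOn (fun y => u (t, y)) {y | (t, y) ∈ Ω} := fun y₁ h₁ y₂ h₂ hlt =>
  sub_pos.1 ((mul_pos ha (sub_pos.2 hlt)).trans_le (hu t y₁ y₂ h₁ h₂ hlt.le).1)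

theorem DecreasesAtRate.exists_arePartialInverses (hu : DecreasesAtRate a b Ω u) (ha : 0 < a)
    (hΩ : dualDomain Ω u = Ω') : ∃ w, ArePartialInverses Ω Ω' u w := by
  have hex : ∀ q ∈ Ω', ∃ y, (q.1, y) ∈ Ω ∧ u (q.1, y) = q.2 := by
    rw [← hΩ]
    rintro _ ⟨p, hp, rfl⟩
    exact ⟨p.2, hp, rfl⟩
  choose! w hw using hex
  refine ⟨w, fun t y hy => ?_, fun t z hz => hw _ hz⟩
  have hmem : (t, u (t, y)) ∈ Ω' := hΩ ▸ ⟨(t, y), hy, rfl⟩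
  obtain ⟨hy', heq⟩ := hw _ hmem
  exact ⟨hmem, (hu.strictAntiOn ha t).injOn hy' hy heq⟩

theorem DecreasesAtRate.inverse (hu : DecreasesAtRate a b Ω u) (ha : 0 < a) (hb : 0 < b)
    (h : ArePartialInverses Ω Ω' u w) : DecreasesAtRate (1 / b) (1 / a) Ω' w := by
  intro t z₁ z₂ h₁ h₂ hz
  obtain ⟨m₁, e₁⟩ := h.2 t z₁ h₁
  obtain ⟨m₂, e₂⟩ := h.2 t z₂ h₂
  have hle : w (t, z₂) ≤ w (t, z₁) :=
    ((hu.strictAntiOn ha t).le_iff_ge m₁ m₂).1 (by simpa only [e₁, e₂] using hz)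
  obtain ⟨hlower, hupper⟩ := hu t _ _ m₂ m₁ hle
  rw [e₁, e₂] at hlower hupper
  rw [one_div_mul_eq_div, one_div_mul_eq_div, div_le_iff₀' hb, le_div_iff₀' ha]
  exact ⟨hupper, hlower⟩

theorem DecreasesAtRate.mul_abs_sub_le (hu : DecreasesAtRate a b Ω u) {t y₁ y₂ : ℝ}
    (h₁ : (t, y₁) ∈ Ω) (h₂ : (t, y₂) ∈ Ω) : a * |y₁ - y₂| ≤ |u (t, y₁) - u (t, y₂)| := by
  wlog hle : y₁ ≤ y₂ generalizing y₁ y₂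
  · simpa only [abs_sub_comm] using this h₂ h₁ (le_of_not_ge hle)
  rw [abs_sub_comm, abs_of_nonneg (sub_nonneg.2 hle)]
  exact (hu t y₁ y₂ h₁ h₂ hle).1.trans (le_abs_self _)

theorem SatisfiesValue.inverse {τmin τmax : ℝ} {t y z : ℝ → ℝ} {C C' : ℝ × ℝ → ℝ}
    (hu : SatisfiesValue τmin τmax t y C u) (hmem : ∀ τ ∈ Icc τmin τmax, (t τ, y τ) ∈ Ω)
    (hz : ∀ τ ∈ Icc τmin τmax, z τ = C (t τ, y τ))
    (hy : ∀ τ ∈ Icc τmin τmax, y τ = C' (t τ, z τ)) (h : ArePartialInverses Ω Ω' u w) :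
    SatisfiesValue τmin τmax t z C' w := by
  intro τ hτ
  rw [← hy τ hτ, hz τ hτ, ← hu τ hτ]
  exact (h.1 _ _ (hmem τ hτ)).2

end PartialInverses

section Domains

variable {Ω Ω' : Set (ℝ × ℝ)} {u w : ℝ × ℝ → ℝ} {a b : ℝ}

theorem IsDomain.eventually_exists_mem (hΩ : IsDomain Ω) {p : ℝ × ℝ} (hp : p ∈ Ω)
    {P : ℝ × ℝ → Prop} (hP : ∀ᶠ q in 𝓝[Ω] p, P q) :
    ∀ᶠ t in 𝓝[Prod.fst '' Ω] p.1, ∃ y, (t, y) ∈ Ω ∧ P (t, y) := by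
  obtain ⟨ε, hε, hball⟩ := Metric.mem_nhdsWithin_iff.1 hP
  filter_upwards [hΩ.lsc p hp ε hε, mem_nhdsWithin_of_mem_nhds (Metric.ball_mem_nhds p.1 hε)]
    with t ⟨y, hy, hyp⟩ ht
  exact ⟨y, hy, hball ⟨max_lt ht hyp, hy⟩⟩

theorem ArePartialInverses.continuousOn (h : ArePartialInverses Ω Ω' u w) (hΩ : IsDomain Ω)
    (hu : DecreasesAtRate a b Ω u) (hc : ContinuousOn u Ω) (ha : 0 < a) :
    ContinuousOn w Ω' := by
  intro q₀ hq₀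
  obtain ⟨hp₀, hup₀⟩ := h.2 _ _ hq₀
  refine Metric.tendsto_nhds.2 fun ε hε => ?_
  have hu_near : ∀ᶠ p in 𝓝[Ω] (q₀.1, w q₀), dist (u p) q₀.2 < a * (ε / 4) := by
    simpa only [hup₀] using Metric.tendsto_nhds.1 (hc _ hp₀) (a * (ε / 4)) (by positivity)
  have hy_near : ∀ᶠ p in 𝓝[Ω] (q₀.1, w q₀), dist p.2 (w q₀) < ε / 2 :=
    Metric.tendsto_nhds.1 continuous_snd.continuousWithinAt (ε / 2) (by positivity)
  have hfst : Tendsto Prod.fst (𝓝[Ω'] q₀) (𝓝[Prod.fst '' Ω] q₀.1) :=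
    continuous_fst.continuousWithinAt.tendsto_nhdsWithin
      fun q hq => ⟨_, (h.2 _ _ hq).1, rfl⟩
  have hz_near : ∀ᶠ q in 𝓝[Ω'] q₀, dist q.2 q₀.2 < a * (ε / 4) :=
    Metric.tendsto_nhds.1 continuous_snd.continuousWithinAt (a * (ε / 4)) (by positivity)
  filter_upwards [hfst.eventually (hΩ.eventually_exists_mem hp₀ (hu_near.and hy_near)), hz_near,
    self_mem_nhdsWithin] with q ⟨y, hy, huy, hyw⟩ hz hq
  obtain ⟨hwq, huwq⟩ := h.2 _ _ hq
  have hwy : dist (w q) y < ε / 2 := by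
    refine lt_of_mul_lt_mul_left ?_ ha.le
    calc a * dist (w q) y ≤ dist (u (q.1, w q)) (u (q.1, y)) := hu.mul_abs_sub_le hwq hy
      _ = dist q.2 (u (q.1, y)) := by rw [huwq]
      _ ≤ dist q.2 q₀.2 + dist (u (q.1, y)) q₀.2 := dist_triangle_right _ _ _
      _ < a * (ε / 2) := by linarith
  linarith [dist_triangle (w q) y (w q₀)]

theorem ArePartialInverses.mem_interior (h : ArePartialInverses Ω Ω' u w) (hΩ : IsDomain Ω)
    (hw : DecreasesAtRate a b Ω' w) (hc : ContinuousOn w Ω') (ha : 0 < a) {q : ℝ × ℝ}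
    (hq : q ∈ interior Ω') : (q.1, w q) ∈ interior Ω := by
  have hvert : ∀ᶠ z in 𝓝 q.2, (q.1, z) ∈ interior Ω' :=
    (Continuous.prodMk_right q.1).tendsto q.2 (isOpen_interior.mem_nhds hq)
  obtain ⟨z₁, hz₁, hlt₁⟩ :=
    ((hvert.filter_mono nhdsWithin_le_nhds).and (self_mem_nhdsWithin (s := Iio q.2))).exists
  obtain ⟨z₂, hz₂, hlt₂⟩ :=
    ((hvert.filter_mono nhdsWithin_le_nhds).and (self_mem_nhdsWithin (s := Ioi q.2))).exists
  have hanti := hw.strictAntiOn ha q.1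
  have hqΩ' : q ∈ Ω' := interior_subset hq
  have hz₁Ω' : (q.1, z₁) ∈ Ω' := interior_subset hz₁
  have hz₂Ω' : (q.1, z₂) ∈ Ω' := interior_subset hz₂
  have hw₁ : w q < w (q.1, z₁) := hanti hz₁Ω' hqΩ' hlt₁
  have hw₂ : w (q.1, z₂) < w q := hanti hqΩ' hz₂Ω' hlt₂
  have hline (z : ℝ) : Tendsto (fun p : ℝ × ℝ => (p.1, z)) (𝓝 (q.1, w q)) (𝓝 (q.1, z)) :=
    (continuous_fst.prodMk continuous_const).tendsto (q.1, w q)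
  have hcont {z : ℝ} (hz : (q.1, z) ∈ interior Ω') :
      Tendsto (fun p : ℝ × ℝ => w (p.1, z)) (𝓝 (q.1, w q)) (𝓝 (w (q.1, z))) :=
    (hc.continuousAt (mem_interior_iff_mem_nhds.1 hz)).tendsto.comp (hline z)
  have hsnd : Tendsto Prod.snd (𝓝 (q.1, w q)) (𝓝 (w q)) := continuous_snd.tendsto _
  rw [mem_interior_iff_mem_nhds]
  filter_upwards [hline z₁ (mem_interior_iff_mem_nhds.1 hz₁),
    hline z₂ (mem_interior_iff_mem_nhds.1 hz₂), hsnd.eventually_lt (hcont hz₁) hw₁,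
    (hcont hz₂).eventually_lt hsnd hw₂] with p hp₁ hp₂ hlt hgt
  exact (hΩ.slice p.1).out (h.2 _ _ hp₂).1 (h.2 _ _ hp₁).1 ⟨hgt.le, hlt.le⟩

end Domains

section LocalInverses

variable {E : Type*} [NormedAddCommGroup E] [NormedSpace ℝ E] {φ Φ : E × ℝ → ℝ} {p : E × ℝ}

theorem apply_eq_add_mul (L : E × ℝ →L[ℝ] ℝ) (v : E × ℝ) : L v = L (v.1, 0) + v.2 * L (0, 1) := by
  rw [← smul_eq_mul, ← map_smul, ← map_add]
  simp

/-- The derivative at `(s, φ (s, y))` of the partial inverse, in the real variable, of a function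
`φ` with derivative `L` at `(s, y)`. It is `0` by convention if `L (0, 1) = 0`. -/
noncomputable def partialInverseDeriv (L : E × ℝ →L[ℝ] ℝ) : E × ℝ →L[ℝ] ℝ :=
  (L (0, 1))⁻¹ •
    (ContinuousLinearMap.snd ℝ E ℝ - L ∘L .inl ℝ E ℝ ∘L ContinuousLinearMap.fst ℝ E ℝ)

theorem partialInverseDeriv_apply (L : E × ℝ →L[ℝ] ℝ) (v : E × ℝ) :
    partialInverseDeriv L v = (v.2 - L (v.1, 0)) / L (0, 1) := by
  simp [partialInverseDeriv, div_eq_inv_mul]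

theorem eq_partialInverseDeriv {L M : E × ℝ →L[ℝ] ℝ} (hL : L (0, 1) ≠ 0)
    (hLM : ∀ v, L (v.1, M v) = v.2) : M = partialInverseDeriv L := by
  refine ContinuousLinearMap.ext fun v => ?_
  rw [partialInverseDeriv_apply, eq_div_iff hL, ← hLM v, apply_eq_add_mul L (v.1, M v)]
  ring

theorem exists_contDiffAt_partialInverse [CompleteSpace E] (hφ : ContDiffAt ℝ 1 φ p)
    (hp : fderiv ℝ φ p (0, 1) ≠ 0) :
    ∃ Φ : E × ℝ → ℝ, ContDiffAt ℝ 1 Φ (p.1, φ p) ∧ Φ (p.1, φ p) = p.2 ∧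
      ∀ᶠ z in 𝓝 (p.1, φ p), φ (z.1, Φ z) = z.2 := by
  let g : (E × ℝ) × ℝ → ℝ := fun x => φ (x.1.1, x.2) - x.1.2
  let x₀ : (E × ℝ) × ℝ := ((p.1, φ p), p.2)
  have hg : ContDiffAt ℝ 1 g x₀ :=
    (ContDiffAt.comp x₀ (f := fun x : (E × ℝ) × ℝ => (x.1.1, x.2)) hφ (by fun_prop)).sub
      (by fun_prop)
  have hg' : HasFDerivAt g _ x₀ :=
    (HasFDerivAt.comp x₀ (f := fun x : (E × ℝ) × ℝ => (x.1.1, x.2))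
      (hφ.differentiableAt one_ne_zero).hasFDerivAt
      ((hasFDerivAt_fst.comp x₀ hasFDerivAt_fst).prodMk hasFDerivAt_snd)).sub
      (hasFDerivAt_snd.comp x₀ hasFDerivAt_fst)
  have hinv : (fderiv ℝ g x₀ ∘L .inr ℝ (E × ℝ) ℝ).IsInvertible := by
    refine ⟨ContinuousLinearEquiv.unitsEquivAut ℝ (Units.mk0 _ hp), ?_⟩
    ext
    simp [hg'.fderiv]
  refine ⟨hg.implicitFunction one_ne_zero hinv, hg.contDiffAt_implicitFunction one_ne_zero hinv,
    hg.implicitFunction_apply_self one_ne_zero hinv, ?_⟩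
  filter_upwards [hg.eventually_apply_implicitFunction one_ne_zero hinv] with z hz
  simpa [g, x₀, sub_eq_zero] using hz

theorem fderiv_partialInverse (hφ : DifferentiableAt ℝ φ p) (hp : fderiv ℝ φ p (0, 1) ≠ 0)
    (hΦ : DifferentiableAt ℝ Φ (p.1, φ p)) (hΦp : Φ (p.1, φ p) = p.2)
    (hinv : ∀ᶠ z in 𝓝 (p.1, φ p), φ (z.1, Φ z) = z.2) :
    fderiv ℝ Φ (p.1, φ p) = partialInverseDeriv (fderiv ℝ φ p) := by
  refine eq_partialInverseDeriv hp fun v => ?_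
  have hφ' : HasFDerivAt φ (fderiv ℝ φ p) (p.1, Φ (p.1, φ p)) := by
    simpa only [hΦp] using hφ.hasFDerivAt
  have hcomp : HasFDerivAt (fun z : E × ℝ => φ (z.1, Φ z)) _ (p.1, φ p) :=
    HasFDerivAt.comp (p.1, φ p) hφ' (hasFDerivAt_fst.prodMk hΦ.hasFDerivAt)
  exact DFunLike.congr_fun (hcomp.unique (hasFDerivAt_snd.congr_of_eventuallyEq hinv)) v

theorem eventually_le_iff_of_fderiv_neg (hφ : HasStrictFDerivAt φ (fderiv ℝ φ p) p)
    (hneg : fderiv ℝ φ p (0, 1) < 0) :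
    ∀ᶠ q in 𝓝 (p, p), q.1.1 = q.2.1 → (φ q.1 ≤ φ q.2 ↔ q.2.2 ≤ q.1.2) := by
  set d := fderiv ℝ φ p (0, 1)
  filter_upwards [hφ.isLittleO.bound (c := -d / 2) (by linarith)] with q hq hfst
  have hsub : q.1 - q.2 = (q.1.2 - q.2.2) • ((0, 1) : E × ℝ) := by
    ext <;> simp [hfst]
  rw [hsub, map_smul, norm_smul] at hq
  have hbound : |φ q.1 - φ q.2 - (q.1.2 - q.2.2) * d| ≤ -d / 2 * |q.1.2 - q.2.2| := by
    simpa [Prod.norm_def, d] using hq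
  obtain ⟨hlower, hupper⟩ := abs_le.1 hbound
  rcases le_or_gt q.2.2 q.1.2 with hle | hlt
  · rw [abs_of_nonneg (sub_nonneg.2 hle)] at hupper
    exact iff_of_true (by nlinarith) hle
  · rw [abs_of_neg (sub_neg.2 hlt)] at hlower
    exact iff_of_false (by nlinarith) hlt.not_ge

theorem exists_partialInverse_le_iff [CompleteSpace E] (hφ : ContDiffAt ℝ 1 φ p)
    (hneg : fderiv ℝ φ p (0, 1) < 0) :
    ∃ Φ : E × ℝ → ℝ, ContDiffAt ℝ 1 Φ (p.1, φ p) ∧ Φ (p.1, φ p) = p.2 ∧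
      fderiv ℝ Φ (p.1, φ p) = partialInverseDeriv (fderiv ℝ φ p) ∧
      ∀ᶠ x in 𝓝 ((p.1, φ p), p.2),
        (x.2 ≤ Φ x.1 ↔ x.1.2 ≤ φ (x.1.1, x.2)) ∧ (Φ x.1 ≤ x.2 ↔ φ (x.1.1, x.2) ≤ x.1.2) := by
  obtain ⟨Φ, hΦ, hΦp, hinv⟩ := exists_contDiffAt_partialInverse hφ hneg.ne
  refine ⟨Φ, hΦ, hΦp, fderiv_partialInverse (hφ.differentiableAt one_ne_zero) hneg.ne
    (hΦ.differentiableAt one_ne_zero) hΦp hinv, ?_⟩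
  have hgraph : Tendsto (fun x : (E × ℝ) × ℝ => (x.1.1, Φ x.1)) (𝓝 ((p.1, φ p), p.2)) (𝓝 p) := by
    have : Tendsto (fun z : E × ℝ => (z.1, Φ z)) (𝓝 (p.1, φ p)) (𝓝 (p.1, Φ (p.1, φ p))) :=
      continuousAt_fst.prodMk hΦ.continuousAt
    rw [hΦp] at this
    exact this.comp (continuous_fst.tendsto ((p.1, φ p), p.2))
  have hpoint : Tendsto (fun x : (E × ℝ) × ℝ => (x.1.1, x.2)) (𝓝 ((p.1, φ p), p.2)) (𝓝 p) :=
    Continuous.tendsto (by fun_prop) ((p.1, φ p), p.2)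
  have hmono := eventually_le_iff_of_fderiv_neg (hφ.hasStrictFDerivAt one_ne_zero) hneg
  filter_upwards [(hgraph.prodMk_nhds hpoint).eventually hmono,
    (hpoint.prodMk_nhds hgraph).eventually hmono,
    (continuous_fst.tendsto ((p.1, φ p), p.2)).eventually hinv] with x h₁ h₂ hx
  simp only [forall_const, hx] at h₁ h₂
  exact ⟨h₁.symm, h₂.symm⟩

end LocalInverses

section Semidifferentials

variable {E : Type*} [NormedAddCommGroup E] [NormedSpace ℝ E] {u : E → ℝ} {p : E} {L : E →L[ℝ] ℝ}

/-- The superdifferential of `u` at `p`, in terms of `C¹` test functions: the derivatives at `p` of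
those `φ` for which `u - φ` has a local maximum at `p`. -/
def superdifferential (u : E → ℝ) (p : E) : Set (E →L[ℝ] ℝ) :=
  {L | ∃ φ, ContDiffAt ℝ 1 φ p ∧ IsLocalMax (fun q => u q - φ q) p ∧ fderiv ℝ φ p = L}

/-- The subdifferential of `u` at `p`, in terms of `C¹` test functions: the derivatives at `p` of
those `φ` for which `u - φ` has a local minimum at `p`. -/
def subdifferential (u : E → ℝ) (p : E) : Set (E →L[ℝ] ℝ) :=
  {L | ∃ φ, ContDiffAt ℝ 1 φ p ∧ IsLocalMin (fun q => u q - φ q) p ∧ fderiv ℝ φ p = L}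

theorem mem_superdifferential_iff : L ∈ superdifferential u p ↔
    ∃ φ, ContDiffAt ℝ 1 φ p ∧ φ p = u p ∧ u ≤ᶠ[𝓝 p] φ ∧ fderiv ℝ φ p = L := by
  constructor
  · rintro ⟨φ, hφ, hmax, hL⟩
    refine ⟨fun q => φ q + (u p - φ p), hφ.add contDiffAt_const, add_sub_cancel _ _, ?_,
      (fderiv_add_const _).trans hL⟩
    filter_upwards [hmax] with q hq
    linarith
  · rintro ⟨φ, hφ, hp, hle, hL⟩
    refine ⟨φ, hφ, ?_, hL⟩
    filter_upwards [hle] with q hq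
    linarith

theorem mem_subdifferential_iff : L ∈ subdifferential u p ↔
    ∃ φ, ContDiffAt ℝ 1 φ p ∧ φ p = u p ∧ φ ≤ᶠ[𝓝 p] u ∧ fderiv ℝ φ p = L := by
  constructor
  · rintro ⟨φ, hφ, hmin, hL⟩
    refine ⟨fun q => φ q + (u p - φ p), hφ.add contDiffAt_const, add_sub_cancel _ _, ?_,
      (fderiv_add_const _).trans hL⟩
    filter_upwards [hmin] with q hq
    linarith
  · rintro ⟨φ, hφ, hp, hle, hL⟩
    refine ⟨φ, hφ, ?_, hL⟩
    filter_upwards [hle] with q hq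
    linarith

theorem le_apply_of_eventually_add_mul_le {φ : E → ℝ} (hφ : HasFDerivAt φ L p) {e : E} {c : ℝ}
    (h : ∀ᶠ r in 𝓝[>] (0 : ℝ), φ p + r * c ≤ φ (p + r • e)) : c ≤ L e := by
  refine ge_of_tendsto (hφ.hasLineDerivAt e).tendsto_slope_zero_right ?_
  filter_upwards [h, self_mem_nhdsWithin] with r hr hpos
  rw [smul_eq_mul, le_inv_mul_iff₀ hpos]
  linarith

end Semidifferentials

section Viscosity

variable {Ω Ω' : Set (ℝ × ℝ)} {u w : ℝ × ℝ → ℝ} {a b : ℝ} {F G H : ℝ → ℝ}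
  {L : ℝ × ℝ →L[ℝ] ℝ} {p q : ℝ × ℝ}

theorem DecreasesAtRate.superdifferential_apply_le (hu : DecreasesAtRate a b Ω u)
    (hp : p ∈ interior Ω) (hL : L ∈ superdifferential u p) : L (0, 1) ≤ -a := by
  obtain ⟨φ, hφ, hφp, hle, rfl⟩ := mem_superdifferential_iff.1 hL
  have hline : Tendsto (fun r : ℝ => p + r • ((0, -1) : ℝ × ℝ)) (𝓝[>] 0) (𝓝 p) :=
    tendsto_nhdsWithin_of_tendsto_nhds (Continuous.tendsto' (by fun_prop) _ _ (by simp))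
  have hslope : a ≤ fderiv ℝ φ p (0, -1) := by
    refine le_apply_of_eventually_add_mul_le (hφ.differentiableAt one_ne_zero).hasFDerivAt ?_
    filter_upwards [hline (mem_interior_iff_mem_nhds.1 hp), hline.eventually hle,
      self_mem_nhdsWithin] with r hrΩ hr hpos
    have hpoint : p + r • ((0, -1) : ℝ × ℝ) = (p.1, p.2 - r) := by
      ext <;> simp [sub_eq_add_neg]
    rw [mem_preimage, hpoint] at hrΩ
    rw [hpoint] at hr ⊢
    linarith [(hu p.1 (p.2 - r) p.2 hrΩ (interior_subset hp)
      (sub_le_self _ (le_of_lt hpos))).1]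
  have hneg : ((0, -1) : ℝ × ℝ) = -(0, 1) := by simp
  rw [hneg, map_neg] at hslope
  exact le_neg_of_le_neg hslope

theorem DecreasesAtRate.subdifferential_apply_le (hu : DecreasesAtRate a b Ω u)
    (hp : p ∈ interior Ω) (hL : L ∈ subdifferential u p) : L (0, 1) ≤ -a := by
  obtain ⟨φ, hφ, hφp, hle, rfl⟩ := mem_subdifferential_iff.1 hL
  have hline : Tendsto (fun r : ℝ => p + r • ((0, 1) : ℝ × ℝ)) (𝓝[>] 0) (𝓝 p) :=
    tendsto_nhdsWithin_of_tendsto_nhds (Continuous.tendsto' (by fun_prop) _ _ (by simp))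
  have hslope : a ≤ (-fderiv ℝ φ p) (0, 1) := by
    refine le_apply_of_eventually_add_mul_le (hφ.differentiableAt one_ne_zero).hasFDerivAt.neg ?_
    filter_upwards [hline (mem_interior_iff_mem_nhds.1 hp), hline.eventually hle,
      self_mem_nhdsWithin] with r hrΩ hr hpos
    have hpoint : p + r • ((0, 1) : ℝ × ℝ) = (p.1, p.2 + r) := by
      ext <;> simp
    rw [mem_preimage, hpoint] at hrΩ
    rw [Pi.neg_apply, Pi.neg_apply]
    rw [hpoint] at hr ⊢
    linarith [(hu p.1 p.2 (p.2 + r) (interior_subset hp) hrΩ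
      (le_add_of_nonneg_right (le_of_lt hpos))).1]
  exact le_neg_of_le_neg hslope

theorem isViscositySubsolution_iff : IsViscositySubsolution H Ω u ↔ ContinuousOn u Ω ∧
    ∀ p ∈ interior Ω, ∀ L ∈ superdifferential u p, L (1, 0) + H (L (0, 1)) ≤ 0 :=
  and_congr_right' ⟨fun h p hp _ ⟨φ, hφ, hmax, hL⟩ => hL ▸ h φ p hp hφ hmax,
    fun h φ p hp hφ hmax => h p hp _ ⟨φ, hφ, hmax, rfl⟩⟩

theorem isViscositySupersolution_iff : IsViscositySupersolution H Ω u ↔ ContinuousOn u Ω ∧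
    ∀ p ∈ interior Ω, ∀ L ∈ subdifferential u p, 0 ≤ L (1, 0) + H (L (0, 1)) :=
  and_congr_right' ⟨fun h p hp _ ⟨φ, hφ, hmin, hL⟩ => hL ▸ h φ p hp hφ hmin,
    fun h φ p hp hφ hmin => h p hp _ ⟨φ, hφ, hmin, rfl⟩⟩

theorem ArePartialInverses.tendsto_nhds (h : ArePartialInverses Ω Ω' u w) (hc : ContinuousOn u Ω)
    (hq : q ∈ Ω') (hq' : (q.1, w q) ∈ interior Ω) :
    Tendsto u (𝓝 (q.1, w q)) (𝓝 q.2) := by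
  simpa only [ContinuousAt, (h.2 _ _ hq).2] using
    hc.continuousAt (mem_interior_iff_mem_nhds.1 hq')

theorem ArePartialInverses.partialInverseDeriv_mem_superdifferential
    (h : ArePartialInverses Ω Ω' u w) (hc : ContinuousOn u Ω) (hq : q ∈ Ω')
    (hq' : (q.1, w q) ∈ interior Ω) (hL : L ∈ superdifferential w q) (hneg : L (0, 1) < 0) :
    partialInverseDeriv L ∈ superdifferential u (q.1, w q) := by
  obtain ⟨φ, hφ, hφq, hle, rfl⟩ := mem_superdifferential_iff.1 hL
  obtain ⟨Φ, hΦ, hΦq, hΦL, hiff⟩ := exists_partialInverse_le_iff hφ hneg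
  rw [hφq] at hΦ hΦq hΦL hiff
  have hu := h.tendsto_nhds hc hq hq'
  refine mem_superdifferential_iff.2 ⟨Φ, hΦ, hΦq.trans (h.2 _ _ hq).2.symm, ?_, hΦL⟩
  filter_upwards [mem_interior_iff_mem_nhds.1 hq', (tendsto_id.prodMk_nhds hu).eventually hiff,
    ((continuous_fst.tendsto (q.1, w q)).prodMk_nhds hu).eventually hle] with z hz hzΦ hzφ
  exact hzΦ.1.2 ((h.1 _ _ hz).2.symm.trans_le hzφ)

theorem ArePartialInverses.partialInverseDeriv_mem_subdifferential
    (h : ArePartialInverses Ω Ω' u w) (hc : ContinuousOn u Ω) (hq : q ∈ Ω')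
    (hq' : (q.1, w q) ∈ interior Ω) (hL : L ∈ subdifferential w q) (hneg : L (0, 1) < 0) :
    partialInverseDeriv L ∈ subdifferential u (q.1, w q) := by
  obtain ⟨φ, hφ, hφq, hle, rfl⟩ := mem_subdifferential_iff.1 hL
  obtain ⟨Φ, hΦ, hΦq, hΦL, hiff⟩ := exists_partialInverse_le_iff hφ hneg
  rw [hφq] at hΦ hΦq hΦL hiff
  have hu := h.tendsto_nhds hc hq hq'
  refine mem_subdifferential_iff.2 ⟨Φ, hΦ, hΦq.trans (h.2 _ _ hq).2.symm, ?_, hΦL⟩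
  filter_upwards [mem_interior_iff_mem_nhds.1 hq', (tendsto_id.prodMk_nhds hu).eventually hiff,
    ((continuous_fst.tendsto (q.1, w q)).prodMk_nhds hu).eventually hle] with z hz hzΦ hzφ
  exact hzΦ.2.2 (hzφ.trans_eq (h.1 _ _ hz).2)

theorem add_neg_eq_mul_partialInverseDeriv (hFG : EqOn G (spacingVelocity F) (Ioi 0))
    (hneg : L (0, 1) < 0) :
    L (1, 0) + -G (-L (0, 1)) = -L (0, 1) *
      (partialInverseDeriv L (1, 0) + -F (-partialInverseDeriv L (0, 1))) := by
  have hne := hneg.ne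
  rw [hFG (neg_pos.2 hneg), spacingVelocity, partialInverseDeriv_apply, partialInverseDeriv_apply,
    one_div_neg_eq_neg_one_div, Prod.mk_zero_zero, map_zero, sub_zero, zero_sub]
  field_simp
  ring

theorem IsViscositySubsolution.inverse (hu : IsViscositySubsolution (fun p => -F (-p)) Ω u)
    (hΩ : IsDomain Ω) (hr : DecreasesAtRate a b Ω u) (ha : 0 < a) (hb : 0 < b)
    (h : ArePartialInverses Ω Ω' u w) (hFG : EqOn G (spacingVelocity F) (Ioi 0)) :
    IsViscositySubsolution (fun p => -G (-p)) Ω' w := by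
  have hw := hr.inverse ha hb h
  have hwc := h.continuousOn hΩ hr hu.1 ha
  refine isViscositySubsolution_iff.2 ⟨hwc, fun q hq L hL => ?_⟩
  have hq' := h.mem_interior hΩ hw hwc (one_div_pos.2 hb) hq
  have hneg : L (0, 1) < 0 :=
    (hw.superdifferential_apply_le hq hL).trans_lt (neg_neg_of_pos (one_div_pos.2 hb))
  have hM := h.partialInverseDeriv_mem_superdifferential hu.1 (interior_subset hq) hq' hL hneg
  rw [add_neg_eq_mul_partialInverseDeriv hFG hneg]
  exact mul_nonpos_of_nonneg_of_nonpos (neg_nonneg.2 hneg.le)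
    ((isViscositySubsolution_iff.1 hu).2 _ hq' _ hM)

theorem IsViscositySupersolution.inverse (hu : IsViscositySupersolution (fun p => -F (-p)) Ω u)
    (hΩ : IsDomain Ω) (hr : DecreasesAtRate a b Ω u) (ha : 0 < a) (hb : 0 < b)
    (h : ArePartialInverses Ω Ω' u w) (hFG : EqOn G (spacingVelocity F) (Ioi 0)) :
    IsViscositySupersolution (fun p => -G (-p)) Ω' w := by
  have hw := hr.inverse ha hb h
  have hwc := h.continuousOn hΩ hr hu.1 ha
  refine isViscositySupersolution_iff.2 ⟨hwc, fun q hq L hL => ?_⟩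
  have hq' := h.mem_interior hΩ hw hwc (one_div_pos.2 hb) hq
  have hneg : L (0, 1) < 0 :=
    (hw.subdifferential_apply_le hq hL).trans_lt (neg_neg_of_pos (one_div_pos.2 hb))
  have hM := h.partialInverseDeriv_mem_subdifferential hu.1 (interior_subset hq) hq' hL hneg
  rw [add_neg_eq_mul_partialInverseDeriv hFG hneg]
  exact mul_nonneg (neg_nonneg.2 hneg.le) ((isViscositySupersolution_iff.1 hu).2 _ hq' _ hM)

theorem IsViscositySolution.inverse (hu : IsViscositySolution (fun p => -F (-p)) Ω u)
    (hΩ : IsDomain Ω) (hr : DecreasesAtRate a b Ω u) (ha : 0 < a) (hb : 0 < b)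
    (h : ArePartialInverses Ω Ω' u w) (hFG : EqOn G (spacingVelocity F) (Ioi 0)) :
    IsViscositySolution (fun p => -G (-p)) Ω' w :=
  ⟨hu.1.inverse hΩ hr ha hb h hFG, hu.2.inverse hΩ hr ha hb h hFG⟩

end Viscosity

section Solutions

variable {f : ℝ → ℝ} {δ ρmax : ℝ} {ΩE ΩL : Set (ℝ × ℝ)} {τmin τmax : ℝ} {t x n : ℝ → ℝ}
  {CE CL N X : ℝ × ℝ → ℝ}

theorem spacingVelocity_spacingVelocity {s : ℝ} (hs : s ≠ 0) :
    spacingVelocity (spacingVelocity f) s = f s := by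
  rw [spacingVelocity, spacingVelocity, one_div_one_div, mul_assoc, one_div_mul_cancel hs, mul_one]

theorem IsEulerianSolution.inverse (hN : IsEulerianSolution f δ ρmax ΩE τmin τmax t x CE N)
    (hδ : 0 < δ) (hρ : 0 < ρmax) (hΩE : IsDomain ΩE)
    (hmem : ∀ τ ∈ Icc τmin τmax, (t τ, x τ) ∈ ΩE)
    (hn : ∀ τ ∈ Icc τmin τmax, n τ = CE (t τ, x τ))
    (hx : ∀ τ ∈ Icc τmin τmax, x τ = CL (t τ, n τ)) (h : ArePartialInverses ΩE ΩL N X) :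
    IsLagrangianSolution f δ ρmax ΩL τmin τmax t n CL X where
  viscosity := hN.viscosity.inverse hΩE hN.density hδ hρ h fun _ _ => rfl
  spacing := hN.density.inverse hδ hρ h
  value := hN.value.inverse hmem hn hx h

theorem IsLagrangianSolution.inverse (hX : IsLagrangianSolution f δ ρmax ΩL τmin τmax t n CL X)
    (hδ : 0 < δ) (hρ : 0 < ρmax) (hΩL : IsDomain ΩL)
    (hmem : ∀ τ ∈ Icc τmin τmax, (t τ, n τ) ∈ ΩL)
    (hn : ∀ τ ∈ Icc τmin τmax, n τ = CE (t τ, x τ))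
    (hx : ∀ τ ∈ Icc τmin τmax, x τ = CL (t τ, n τ)) (h : ArePartialInverses ΩL ΩE X N) :
    IsEulerianSolution f δ ρmax ΩE τmin τmax t x CE N where
  viscosity := hX.viscosity.inverse hΩL hX.spacing (one_div_pos.2 hρ) (one_div_pos.2 hδ) h
    fun _ hs => (spacingVelocity_spacingVelocity (ne_of_gt hs)).symm
  density := by
    simpa only [one_div_one_div] using
      hX.spacing.inverse (one_div_pos.2 hρ) (one_div_pos.2 hδ) h
  value := hX.value.inverse hmem hx hn h

end Solutions

section Uniqueness

variable {Ω Ω' : Set (ℝ × ℝ)} {P Q : (ℝ × ℝ → ℝ) → Prop} {u w : ℝ × ℝ → ℝ}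

/-- Partial inversion solves the problem `Q` on `Ω'` from the problem `P` on `Ω`: every solution of
`P` with image `Ω'` has a partial inverse that is a solution of `Q`. -/
def InvertsTo (Ω Ω' : Set (ℝ × ℝ)) (P Q : (ℝ × ℝ → ℝ) → Prop) : Prop :=
  ∀ u, P u → dualDomain Ω u = Ω' → ∃ w, ArePartialInverses Ω Ω' u w ∧ Q w

/-- `u` is the only solution on `Ω` of the problem `P` with image `Ω'`. Solutions are functions on
all of `ℝ × ℝ`, so they are compared on `Ω` only. -/
def IsUniqueSolution (Ω Ω' : Set (ℝ × ℝ)) (P : (ℝ × ℝ → ℝ) → Prop) (u : ℝ × ℝ → ℝ) : Prop :=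
  (P u ∧ dualDomain Ω u = Ω') ∧ ∀ u', P u' → dualDomain Ω u' = Ω' → EqOn u' u Ω

theorem InvertsTo.arePartialInverses (hPQ : InvertsTo Ω Ω' P Q) (hu : P u)
    (hD : dualDomain Ω u = Ω') (huniq : ∀ w', Q w' → dualDomain Ω' w' = Ω → EqOn w' w Ω') :
    ArePartialInverses Ω Ω' u w := by
  obtain ⟨w', h, hw'⟩ := hPQ u hu hD
  exact h.congr_right (huniq w' hw' h.symm.dualDomain_eq)

theorem InvertsTo.exists_isUniqueSolution (hPQ : InvertsTo Ω Ω' P Q) (hQP : InvertsTo Ω' Ω Q P)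
    (hP : ∃ u, IsUniqueSolution Ω Ω' P u) : ∃ w, IsUniqueSolution Ω' Ω Q w := by
  obtain ⟨u, ⟨hu, hD⟩, huniq⟩ := hP
  obtain ⟨w, h, hw⟩ := hPQ u hu hD
  exact ⟨w, ⟨hw, h.symm.dualDomain_eq⟩, fun w' hw' hD' =>
    (hQP.arePartialInverses hw' hD' huniq).symm.eqOn h⟩

end Uniqueness

end LWR

theorem proposition3_general
    {f : ℝ → ℝ} {δ ρmax : ℝ} (hδ : 0 < δ) (hρ : 0 < ρmax)
    {ΩE ΩL : Set (ℝ × ℝ)} (hΩE : LWR.IsDomain ΩE) (hΩL : LWR.IsDomain ΩL)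
    {τmin τmax : ℝ} {t x n : ℝ → ℝ} {CE CL : ℝ × ℝ → ℝ}
    (hE : ∀ τ ∈ Set.Icc τmin τmax, (t τ, x τ) ∈ ΩE)
    (hL : ∀ τ ∈ Set.Icc τmin τmax, (t τ, n τ) ∈ ΩL)
    (hn : ∀ τ ∈ Set.Icc τmin τmax, n τ = CE (t τ, x τ))
    (hx : ∀ τ ∈ Set.Icc τmin τmax, x τ = CL (t τ, n τ)) :
    (∀ N : ℝ × ℝ → ℝ, LWR.IsEulerianSolution f δ ρmax ΩE τmin τmax t x CE N →
      LWR.dualDomain ΩE N = ΩL →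
      ∃ X : ℝ × ℝ → ℝ, LWR.ArePartialInverses ΩE ΩL N X ∧
        LWR.IsLagrangianSolution f δ ρmax ΩL τmin τmax t n CL X) ∧
    (∀ X : ℝ × ℝ → ℝ, LWR.IsLagrangianSolution f δ ρmax ΩL τmin τmax t n CL X →
      LWR.dualDomain ΩL X = ΩE →
      ∃ N : ℝ × ℝ → ℝ, LWR.ArePartialInverses ΩE ΩL N X ∧
        LWR.IsEulerianSolution f δ ρmax ΩE τmin τmax t x CE N) ∧
    (∀ N X : ℝ × ℝ → ℝ, LWR.IsEulerianSolution f δ ρmax ΩE τmin τmax t x CE N →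
      LWR.dualDomain ΩE N = ΩL →
      LWR.IsLagrangianSolution f δ ρmax ΩL τmin τmax t n CL X →
      (∀ X' : ℝ × ℝ → ℝ, LWR.IsLagrangianSolution f δ ρmax ΩL τmin τmax t n CL X' →
        LWR.dualDomain ΩL X' = ΩE → Set.EqOn X' X ΩL) →
      LWR.ArePartialInverses ΩE ΩL N X) ∧
    (∀ N X : ℝ × ℝ → ℝ, LWR.IsLagrangianSolution f δ ρmax ΩL τmin τmax t n CL X →
      LWR.dualDomain ΩL X = ΩE →
      LWR.IsEulerianSolution f δ ρmax ΩE τmin τmax t x CE N →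
      (∀ N' : ℝ × ℝ → ℝ, LWR.IsEulerianSolution f δ ρmax ΩE τmin τmax t x CE N' →
        LWR.dualDomain ΩE N' = ΩL → Set.EqOn N' N ΩE) →
      LWR.ArePartialInverses ΩE ΩL N X) ∧
    ((∃ N : ℝ × ℝ → ℝ, (LWR.IsEulerianSolution f δ ρmax ΩE τmin τmax t x CE N ∧
        LWR.dualDomain ΩE N = ΩL) ∧
        ∀ N' : ℝ × ℝ → ℝ, LWR.IsEulerianSolution f δ ρmax ΩE τmin τmax t x CE N' →
          LWR.dualDomain ΩE N' = ΩL → Set.EqOn N' N ΩE) ↔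
      (∃ X : ℝ × ℝ → ℝ, (LWR.IsLagrangianSolution f δ ρmax ΩL τmin τmax t n CL X ∧
        LWR.dualDomain ΩL X = ΩE) ∧
        ∀ X' : ℝ × ℝ → ℝ, LWR.IsLagrangianSolution f δ ρmax ΩL τmin τmax t n CL X' →
          LWR.dualDomain ΩL X' = ΩE → Set.EqOn X' X ΩL)) := by
  have hEL : LWR.InvertsTo ΩE ΩL (LWR.IsEulerianSolution f δ ρmax ΩE τmin τmax t x CE)
      (LWR.IsLagrangianSolution f δ ρmax ΩL τmin τmax t n CL) := fun N hN hD =>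
    let ⟨X, h⟩ := hN.density.exists_arePartialInverses hδ hD
    ⟨X, h, hN.inverse hδ hρ hΩE hE hn hx h⟩
  have hLE : LWR.InvertsTo ΩL ΩE (LWR.IsLagrangianSolution f δ ρmax ΩL τmin τmax t n CL)
      (LWR.IsEulerianSolution f δ ρmax ΩE τmin τmax t x CE) := fun X hX hD =>
    let ⟨N, h⟩ := hX.spacing.exists_arePartialInverses (one_div_pos.2 hρ) hD
    ⟨N, h, hX.inverse hδ hρ hΩL hL hn hx h⟩
  refine ⟨hEL, fun X hX hD => ?_, fun N X hN hD _ huniq => hEL.arePartialInverses hN hD huniq,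
    fun N X hX hD _ huniq => (hLE.arePartialInverses hX hD huniq).symm,
    hEL.exists_isUniqueSolution hLE, hLE.exists_isUniqueSolution hEL⟩
  obtain ⟨N, h, hN⟩ := hLE X hX hD
  exact ⟨N, h.symm, hN⟩

theorem proposition3
    (f v : ℝ → ℝ) (δ ρmax vmax : ℝ)
    (hf : LWR.IsFundamentalDiagram f v ρmax vmax) (hδ : 0 < δ)
    (ΩE ΩL : Set (ℝ × ℝ)) (hΩE : LWR.IsDomain ΩE) (hΩL : LWR.IsDomain ΩL)
    (τmin τmax : ℝ) (t x n : ℝ → ℝ) (CE CL : ℝ × ℝ → ℝ)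
    (hCE : LWR.IsValueCondition ΩE τmin τmax t x CE)
    (hCL : LWR.IsValueCondition ΩL τmin τmax t n CL)
    (hn : ∀ τ ∈ Set.Icc τmin τmax, n τ = CE (t τ, x τ))
    (hx : ∀ τ ∈ Set.Icc τmin τmax, x τ = CL (t τ, n τ)) :
    -- the partial inverse of an Eulerian solution exists and is a Lagrangian solution
    (∀ N : ℝ × ℝ → ℝ, LWR.IsEulerianSolution f δ ρmax ΩE τmin τmax t x CE N →
      LWR.dualDomain ΩE N = ΩL →
      ∃ X : ℝ × ℝ → ℝ, LWR.ArePartialInverses ΩE ΩL N X ∧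
        LWR.IsLagrangianSolution f δ ρmax ΩL τmin τmax t n CL X) ∧
    -- the partial inverse of a Lagrangian solution exists and is an Eulerian solution
    (∀ X : ℝ × ℝ → ℝ, LWR.IsLagrangianSolution f δ ρmax ΩL τmin τmax t n CL X →
      LWR.dualDomain ΩL X = ΩE →
      ∃ N : ℝ × ℝ → ℝ, LWR.ArePartialInverses ΩE ΩL N X ∧
        LWR.IsEulerianSolution f δ ρmax ΩE τmin τmax t x CE N) ∧
    -- the partial inverse of an Eulerian solution is the Lagrangian solution, if that is unique
    (∀ N X : ℝ × ℝ → ℝ, LWR.IsEulerianSolution f δ ρmax ΩE τmin τmax t x CE N →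
      LWR.dualDomain ΩE N = ΩL →
      LWR.IsLagrangianSolution f δ ρmax ΩL τmin τmax t n CL X →
      (∀ X' : ℝ × ℝ → ℝ, LWR.IsLagrangianSolution f δ ρmax ΩL τmin τmax t n CL X' →
        LWR.dualDomain ΩL X' = ΩE → Set.EqOn X' X ΩL) →
      LWR.ArePartialInverses ΩE ΩL N X) ∧
    -- the partial inverse of a Lagrangian solution is the Eulerian solution, if that is unique
    (∀ N X : ℝ × ℝ → ℝ, LWR.IsLagrangianSolution f δ ρmax ΩL τmin τmax t n CL X →
      LWR.dualDomain ΩL X = ΩE →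
      LWR.IsEulerianSolution f δ ρmax ΩE τmin τmax t x CE N →
      (∀ N' : ℝ × ℝ → ℝ, LWR.IsEulerianSolution f δ ρmax ΩE τmin τmax t x CE N' →
        LWR.dualDomain ΩE N' = ΩL → Set.EqOn N' N ΩE) →
      LWR.ArePartialInverses ΩE ΩL N X) ∧
    -- one of the two problems has exactly one solution if and only if the other one has
    ((∃ N : ℝ × ℝ → ℝ, (LWR.IsEulerianSolution f δ ρmax ΩE τmin τmax t x CE N ∧
        LWR.dualDomain ΩE N = ΩL) ∧
        ∀ N' : ℝ × ℝ → ℝ, LWR.IsEulerianSolution f δ ρmax ΩE τmin τmax t x CE N' →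
          LWR.dualDomain ΩE N' = ΩL → Set.EqOn N' N ΩE) ↔
      (∃ X : ℝ × ℝ → ℝ, (LWR.IsLagrangianSolution f δ ρmax ΩL τmin τmax t n CL X ∧
        LWR.dualDomain ΩL X = ΩE) ∧
        ∀ X' : ℝ × ℝ → ℝ, LWR.IsLagrangianSolution f δ ρmax ΩL τmin τmax t n CL X' →
          LWR.dualDomain ΩL X' = ΩE → Set.EqOn X' X ΩL)) :=
  proposition3_general hδ hf.ρmax_pos hΩE hΩL hCE.mem hCL.mem hn hx
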